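/- Let $d\ge 1$ and $m\ge 1$ be integers, and let $R=(R_{i,i_1,\dots,i_m})_{1\le i,i_1,\dots,i_m\le d}$ be a collection of real numbers such that (T) $R_{i,i_1,\dots,i_m}\ge 0$ for all $i,i_1,\dots,i_m$; (B) there is $\sigma\in(0,\infty)$ such that $\sum_{i=1}^d R_{i,i_1,\dots,i_m}=\sigma$ for all $i_1,\dots,i_m$; (E) $\displaystyle\max_{j,j'\in\{1,\dots,d\}^m}\ \sum_{i=1}^d\bigl|R_{i,j_1,\dots,j_m}-R_{i,j'_1,\dots,j'_m}\bigr|<\frac{2\sigma}{m}$. Let $\Delta_d=\{x\in[0,1]^d:\sum_i x_i=1\}$, and let $\mathcal R:(\mathbb R^d)^m\to\mathbb R^d$ be the multilinear map $$\mathcal R_i\bigl(x^{(1)},\dots,x^{(m)}\bigr)=\sum_{1\le i_1,\dots,i_m\le d}R_{i,i_1,\dots,i_m}\,x^{(1)}_{i_1}\cdots x^{(m)}_{i_m}.$$ Then there exists a unique $x^*\in\Delta_d$ such that $\sigma x^*=\mathcal R(x^*,\dots,x^*)$. Moreover, let $(U(n))_{n\ge0}$ be an $m$-drawing $d$-colour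 Pólya urn with replacement tensor $R$, that is, a process with values in $[0,\infty)^d$ (the initial composition $U(0)$ may be random) such that, for all $n\ge 0$ and $1\le i\le d$, $U_i(n+1)=U_i(n)+R_{i,C_1(n),\dots,C_m(n)}$, where, given $U(0),\dots,U(n)$, the random variables $C_1(n),\dots,C_m(n)$ are independent and identically distributed on $\{1,\dots,d\}$ with probabilities $U_k(n)/\sum_{i=1}^dU_i(n)$, $1\le k\le d$. If $\sum_{i=1}^d U_i(0)>0$ almost surely, then, in probability as $n\to\infty$, $$\frac{U(n)}{\sum_{i=1}^d U_i(n)}\longrightarrow x^*.$$ -/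

import Mathlib

open MeasureTheory ProbabilityTheory Filter

noncomputable section

namespace MultiDrawUrn

/-- A replacement tensor of an `m`-drawing `d`-colour urn: `R i c` is the quantity of colour `i`
that is added when the colours drawn are, in this order, `c 0, …, c (m - 1)`. -/
abbrev Tensor (d m : ℕ) : Type := Fin d → (Fin m → Fin d) → ℝ

/-- The multilinear map `(ℝ^d)^m → ℝ^d` attached to `R`. The argument `x l` is the `l`-th vector. -/
def Tensor.toMap {d m : ℕ} (R : Tensor d m) (x : Fin m → Fin d → ℝ) : Fin d → ℝ :=
  fun i => ∑ c : Fin m → Fin d, R i c * ∏ l : Fin m, x l (c l)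

/-- Assumption (T), tenability. -/
def Tensor.Tenable {d m : ℕ} (R : Tensor d m) : Prop :=
  ∀ i c, 0 ≤ R i c

/-- Assumption (B): the urn is balanced, and `σ ∈ (0, ∞)` is its balance. -/
def Tensor.Balanced {d m : ℕ} (R : Tensor d m) (σ : ℝ) : Prop :=
  0 < σ ∧ ∀ c : Fin m → Fin d, ∑ i, R i c = σ

/-- Assumption (E): the maximum over `c, c'` of `∑ i, |R i c - R i c'|` is less than `2 σ / m`. -/
def Tensor.Ergodic {d m : ℕ} (R : Tensor d m) (σ : ℝ) : Prop :=
  ∀ c c' : Fin m → Fin d, ∑ i, |R i c - R i c'| < 2 * σ / m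

/-- The σ-algebra generated by `U 0, …, U n`. -/
abbrev past {Ω : Type*} {d : ℕ} (U : ℕ → Ω → Fin d → ℝ) (n : ℕ) : MeasurableSpace Ω :=
  ⨆ k : Fin (n + 1), MeasurableSpace.comap (U k) inferInstance

/-- `U` is an `m`-drawing `d`-colour Pólya urn with replacement tensor `R` on the probability
space `(Ω, μ)`, and `C n` is the tuple of colours drawn at time `n`: given `U 0, …, U n`,
the coordinates of `C n` are i.i.d., and each is equal to `k` with probability
`U n k / ∑ i, U n i`. The initial composition `U 0` may be random. -/
structure IsUrn {Ω : Type*} [MeasurableSpace Ω] (μ : Measure Ω) {d m : ℕ} (R : Tensor d m)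
    (U : ℕ → Ω → Fin d → ℝ) (C : ℕ → Ω → Fin m → Fin d) : Prop where
  measurable_comp : ∀ n, Measurable (U n)
  measurable_draw : ∀ n, Measurable (C n)
  nonneg : ∀ n, ∀ᵐ ω ∂μ, ∀ i, 0 ≤ U n ω i
  step : ∀ n, ∀ᵐ ω ∂μ, ∀ i, U (n + 1) ω i = U n ω i + R i (C n ω)
  draw : ∀ n, ∀ c : Fin m → Fin d,
    μ[Set.indicator {ω | C n ω = c} (fun _ => (1 : ℝ)) | past U n]
      =ᵐ[μ] fun ω => ∏ l : Fin m, (U n ω (c l) / ∑ i, U n ω i)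

end MultiDrawUrn

end

/-! Contraction. The difference of two points of the simplex has coordinates summing to zero, so
changing one argument of `R.toMap` moves its value in `ℓ¹` by at most `η / 2` times the change,
where `η` is the maximum in (E) (`sum_abs_sum_mul_le`, `sum_abs_toMap_update_sub_le`). Changing all
`m` arguments shows that `x ↦ R(x, …, x) / σ` contracts the simplex with ratio `κ = m η / (2 σ) < 1`
(`exists_contraction`), which gives the unique fixed point `x`.

Convergence. With `T` the initial total, the total at time `n` is `T + n σ`, and `U n` is `U 0` plus
the sum of the drifts `R.toMap` at the past proportions plus a martingale. Subtracting `(T + n σ) x`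
bounds the `ℓ¹`-distance `D n` from the proportions to `x` by a term of order `T / n`, plus `κ`
times the mean of `D 0, …, D (n - 1)`, plus the martingale divided by `n σ`
(`IsUrn.ae_sum_abs_proportion_sub_le`). The martingale has bounded orthogonal increments, hence is
`O(√n)` in `L¹`. In expectation, `D` is therefore at most `κ < 1` times its Cesàro mean up to
`o(1)`, which forces it to zero (`tendsto_zero_of_le_cesaro`); `L¹` convergence implies convergence
in probability. -/

namespace MultiDrawUrn

/-! ### Contraction of the simplex and the fixed point -/

section

/-- If the vectors `V k` are pairwise at `ℓ¹`-distance at most `η`, then a combination of them whose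
coefficients sum to zero has `ℓ¹`-norm at most `η / 2` times that of the coefficients. -/
lemma sum_abs_sum_mul_le {ι κ : Type*} [Fintype ι] [Fintype κ] {z : κ → ℝ} {V : κ → ι → ℝ} {η : ℝ}
    (hz : ∑ k, z k = 0) (hV : ∀ k k', ∑ i, |V k i - V k' i| ≤ η) :
    ∑ i, |∑ k, z k * V k i| ≤ η / 2 * ∑ k, |z k| := by
  set S := ∑ k, |z k| with hS
  have hS0 : 0 ≤ S := Finset.sum_nonneg fun k _ => abs_nonneg _
  rcases hS0.eq_or_lt with h0 | hpos
  · have hzk : ∀ k, z k = 0 := fun k => by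
      have := (Finset.sum_eq_zero_iff_of_nonneg (fun k _ => abs_nonneg (z k))).1 h0.symm k
        (Finset.mem_univ k)
      exact abs_eq_zero.1 this
    simp [hzk, ← h0]
  have hp : ∑ k, (z k)⁺ = S / 2 := by
    have h1 : ∑ k, (z k)⁺ - ∑ k, (z k)⁻ = 0 := by
      rw [← Finset.sum_sub_distrib, ← hz]
      exact Finset.sum_congr rfl fun k _ => posPart_sub_negPart _
    have h2 : ∑ k, (z k)⁺ + ∑ k, (z k)⁻ = S := by
      rw [← Finset.sum_add_distrib, hS]
      exact Finset.sum_congr rfl fun k _ => posPart_add_negPart _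
    linarith
  have hq : ∑ k, (z k)⁻ = S / 2 := by
    have h2 : ∑ k, (z k)⁺ + ∑ k, (z k)⁻ = S := by
      rw [← Finset.sum_add_distrib, hS]
      exact Finset.sum_congr rfl fun k _ => posPart_add_negPart _
    linarith
  -- The positive and negative parts of `z` both have mass `S / 2`. Coupling them by the product
  -- weights turns the combination into one of differences `V k - V k'`.
  have key : ∀ i, S / 2 * ∑ k, z k * V k i
      = ∑ k, ∑ k', (z k)⁺ * (z k')⁻ * (V k i - V k' i) := fun i => by
    have e1 : ∑ k, ∑ k', (z k)⁺ * (z k')⁻ * (V k i - V k' i)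
        = (∑ k, (z k)⁺ * V k i) * (∑ k', (z k')⁻) - (∑ k, (z k)⁺) * (∑ k', (z k')⁻ * V k' i) := by
      rw [Finset.sum_mul_sum, Finset.sum_mul_sum, ← Finset.sum_sub_distrib]
      refine Finset.sum_congr rfl fun k _ => ?_
      rw [← Finset.sum_sub_distrib]
      exact Finset.sum_congr rfl fun k' _ => by ring
    have e2 : ∑ k, z k * V k i = ∑ k, (z k)⁺ * V k i - ∑ k, (z k)⁻ * V k i := by
      rw [← Finset.sum_sub_distrib]
      refine Finset.sum_congr rfl fun k _ => ?_
      rw [← sub_mul, posPart_sub_negPart]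
    rw [e1, e2, hp, hq]
    ring
  have bound : S / 2 * ∑ i, |∑ k, z k * V k i| ≤ S / 2 * (S / 2 * η) := by
    calc S / 2 * ∑ i, |∑ k, z k * V k i|
        = ∑ i, |∑ k, ∑ k', (z k)⁺ * (z k')⁻ * (V k i - V k' i)| := by
          rw [Finset.mul_sum]
          refine Finset.sum_congr rfl fun i _ => ?_
          rw [← key, abs_mul, abs_of_pos (half_pos hpos)]
      _ ≤ ∑ i, ∑ k, ∑ k', (z k)⁺ * (z k')⁻ * |V k i - V k' i| := by
          refine Finset.sum_le_sum fun i _ => (Finset.abs_sum_le_sum_abs _ _).trans ?_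
          refine Finset.sum_le_sum fun k _ => (Finset.abs_sum_le_sum_abs _ _).trans ?_
          refine Finset.sum_le_sum fun k' _ => ?_
          rw [abs_mul, abs_of_nonneg (mul_nonneg (posPart_nonneg _) (negPart_nonneg _))]
      _ = ∑ k, ∑ k', (z k)⁺ * (z k')⁻ * ∑ i, |V k i - V k' i| := by
          rw [Finset.sum_comm]
          refine Finset.sum_congr rfl fun k _ => ?_
          rw [Finset.sum_comm]
          exact Finset.sum_congr rfl fun k' _ => (Finset.mul_sum _ _ _).symm
      _ ≤ ∑ k, ∑ k', (z k)⁺ * (z k')⁻ * η := by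
          refine Finset.sum_le_sum fun k _ => Finset.sum_le_sum fun k' _ => ?_
          exact mul_le_mul_of_nonneg_left (hV k k')
            (mul_nonneg (posPart_nonneg _) (negPart_nonneg _))
      _ = S / 2 * (S / 2 * η) := by
          simp_rw [← Finset.sum_mul]
          rw [← Finset.sum_mul_sum, hp, hq]
          ring
  have := le_of_mul_le_mul_left bound (half_pos hpos)
  linarith

variable {d m : ℕ} {R : Tensor d m} {σ : ℝ}

lemma sum_prod_eq_one {w : Fin m → Fin d → ℝ} (hw : ∀ l, ∑ k, w l k = 1) :
    ∑ c : Fin m → Fin d, ∏ l, w l (c l) = 1 := by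
  rw [← Fintype.prod_sum]
  simp [hw]

/-- Expansion of `R.toMap` along one of its arguments. -/
lemma toMap_update (w : Fin m → Fin d → ℝ) (a : Fin m) (hw : ∑ k, w a k = 1) (u : Fin d → ℝ)
    (i : Fin d) :
    R.toMap (Function.update w a u) i
      = ∑ k, u k * ∑ c : Fin m → Fin d, R i (Function.update c a k) * ∏ l, w l (c l) := by
  have e1 : ∑ k, u k * ∑ c : Fin m → Fin d, R i (Function.update c a k) * ∏ l, w l (c l)
      = ∑ q : (Fin m → Fin d) × Fin d,
          u q.2 * (R i (Function.update q.1 a q.2) * ∏ l, w l (q.1 l)) := by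
    rw [Fintype.sum_prod_type_right]
    exact Finset.sum_congr rfl fun k _ => Finset.mul_sum _ _ _
  -- Reindex by the involution that exchanges the `a`-th colour of the tuple with the extra colour.
  -- The extra colour then carries the weight `w a`, which sums to one.
  have e2 : ∑ q : (Fin m → Fin d) × Fin d,
          u q.2 * (R i (Function.update q.1 a q.2) * ∏ l, w l (q.1 l))
      = ∑ q : (Fin m → Fin d) × Fin d,
          u (q.1 a) * (R i q.1 * ∏ l, w l (Function.update q.1 a q.2 l)) := by
    refine Finset.sum_nbij' (fun q => (Function.update q.1 a q.2, q.1 a))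
      (fun q => (Function.update q.1 a q.2, q.1 a)) ?_ ?_ ?_ ?_ ?_ <;> simp
  rw [e1, e2, Fintype.sum_prod_type]
  refine Finset.sum_congr rfl fun c _ => ?_
  have h1 : ∀ k, ∏ l, w l (Function.update c a k l)
      = w a k * ∏ l ∈ Finset.univ.erase a, w l (c l) := fun k => by
    rw [← Finset.mul_prod_erase _ _ (Finset.mem_univ a), Function.update_self]
    congr 1
    exact Finset.prod_congr rfl fun l hl => by
      rw [Function.update_of_ne (Finset.ne_of_mem_erase hl)]
  have h2 : ∏ l, Function.update w a u l (c l)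
      = u (c a) * ∏ l ∈ Finset.univ.erase a, w l (c l) := by
    rw [← Finset.mul_prod_erase _ _ (Finset.mem_univ a), Function.update_self]
    congr 1
    exact Finset.prod_congr rfl fun l hl => by
      rw [Function.update_of_ne (Finset.ne_of_mem_erase hl)]
  simp_rw [h1, h2]
  rw [← Finset.mul_sum, ← Finset.mul_sum, ← Finset.sum_mul, hw]
  ring

/-- By `toMap_update`, the difference is a combination, with coefficients `u k - v k` of zero sum,
of averages of columns of `R` under a common product law; such averages remain within `η` of each
other. -/
lemma sum_abs_toMap_update_sub_le {η : ℝ} (hη : ∀ c c', ∑ i, |R i c - R i c'| ≤ η)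
    {w : Fin m → Fin d → ℝ} (hw : ∀ l, w l ∈ stdSimplex ℝ (Fin d)) (a : Fin m)
    {u v : Fin d → ℝ} (huv : ∑ k, u k = ∑ k, v k) :
    ∑ i, |R.toMap (Function.update w a u) i - R.toMap (Function.update w a v) i|
      ≤ η / 2 * ∑ k, |u k - v k| := by
  simp_rw [toMap_update w a (hw a).2, ← Finset.sum_sub_distrib, ← sub_mul]
  refine sum_abs_sum_mul_le (z := fun k => u k - v k)
    (V := fun k i => ∑ c : Fin m → Fin d, R i (Function.update c a k) * ∏ l, w l (c l)) ?_ ?_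
  · rw [Finset.sum_sub_distrib, huv, sub_self]
  intro k k'
  have hprod : ∀ c : Fin m → Fin d, 0 ≤ ∏ l, w l (c l) := fun c =>
    Finset.prod_nonneg fun l _ => (hw l).1 _
  calc _ ≤ ∑ i, ∑ c : Fin m → Fin d,
          |R i (Function.update c a k) - R i (Function.update c a k')| * ∏ l, w l (c l) := by
        refine Finset.sum_le_sum fun i _ => ?_
        rw [← Finset.sum_sub_distrib]
        refine (Finset.abs_sum_le_sum_abs _ _).trans (Finset.sum_le_sum fun c _ => ?_)
        rw [← sub_mul, abs_mul, abs_of_nonneg (hprod c)]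
    _ ≤ ∑ c : Fin m → Fin d, η * ∏ l, w l (c l) := by
        rw [Finset.sum_comm]
        refine Finset.sum_le_sum fun c _ => ?_
        rw [← Finset.sum_mul]
        exact mul_le_mul_of_nonneg_right (hη _ _) (hprod c)
    _ = η := by rw [← Finset.mul_sum, sum_prod_eq_one fun l => (hw l).2, mul_one]

/-- Replace the arguments one at a time and add up the costs; the intermediate tuples are
`s.piecewise x y`. -/
lemma sum_abs_toMap_sub_le {η : ℝ} (hη : ∀ c c', ∑ i, |R i c - R i c'| ≤ η)
    {x y : Fin m → Fin d → ℝ} (hx : ∀ l, x l ∈ stdSimplex ℝ (Fin d))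
    (hy : ∀ l, y l ∈ stdSimplex ℝ (Fin d)) :
    ∑ i, |R.toMap x i - R.toMap y i| ≤ η / 2 * ∑ l, ∑ k, |x l k - y l k| := by
  suffices h : ∀ s : Finset (Fin m), ∑ i, |R.toMap (s.piecewise x y) i - R.toMap y i|
      ≤ η / 2 * ∑ l ∈ s, ∑ k, |x l k - y l k| by
    simpa using h Finset.univ
  intro s
  induction s using Finset.induction_on with
  | empty => simp
  | insert a s ha ih =>
    have hw : ∀ l, s.piecewise x y l ∈ stdSimplex ℝ (Fin d) := fun l => by
      by_cases hl : l ∈ s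
      · rw [Finset.piecewise_eq_of_mem _ _ _ hl]; exact hx l
      · rw [Finset.piecewise_eq_of_notMem _ _ _ hl]; exact hy l
    have hstep := sum_abs_toMap_update_sub_le hη hw a
      (show ∑ k, x a k = ∑ k, y a k by rw [(hx a).2, (hy a).2])
    have hself : Function.update (s.piecewise x y) a (y a) = s.piecewise x y := by
      rw [Function.update_eq_self_iff, Finset.piecewise_eq_of_notMem _ _ _ ha]
    rw [hself] at hstep
    rw [Finset.piecewise_insert, Finset.sum_insert ha, mul_add]
    refine le_trans ?_ (add_le_add hstep ih)
    rw [← Finset.sum_add_distrib]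
    exact Finset.sum_le_sum fun i _ => abs_sub_le _ _ _

/-- `x ↦ R(x, …, x) / σ` is a contraction of the simplex for the `ℓ¹`-distance. -/
lemma exists_contraction (hd : 1 ≤ d) (hm : 1 ≤ m) (hB : R.Balanced σ) (hE : R.Ergodic σ) :
    ∃ κ : ℝ, 0 ≤ κ ∧ κ < 1 ∧ ∀ x ∈ stdSimplex ℝ (Fin d), ∀ y ∈ stdSimplex ℝ (Fin d),
      ∑ i, |R.toMap (fun _ => x) i - R.toMap (fun _ => y) i| ≤ σ * κ * ∑ k, |x k - y k| := by
  have hσ := hB.1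
  have hm' : (0 : ℝ) < m := by exact_mod_cast hm
  have : Nonempty (Fin d) := ⟨⟨0, hd⟩⟩
  -- There are finitely many pairs of tuples, so the maximum is attained and the strict bound (E)
  -- passes to it.
  obtain ⟨p, -, hp⟩ := Finset.exists_max_image
    (Finset.univ : Finset ((Fin m → Fin d) × (Fin m → Fin d)))
    (fun q => ∑ i, |R i q.1 - R i q.2|) Finset.univ_nonempty
  set η := ∑ i, |R i p.1 - R i p.2| with hη
  have hη0 : 0 ≤ η := Finset.sum_nonneg fun _ _ => abs_nonneg _
  have hlt : η < 2 * σ / m := hE p.1 p.2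
  refine ⟨m * η / (2 * σ), by positivity, ?_, fun x hx y hy => ?_⟩
  · rw [div_lt_one (by positivity)]
    rw [lt_div_iff₀ hm'] at hlt
    linarith
  · refine (sum_abs_toMap_sub_le (fun c c' => hp (c, c') (Finset.mem_univ _))
      (fun _ => hx) (fun _ => hy)).trans (le_of_eq ?_)
    rw [Finset.sum_const, Finset.card_univ, Fintype.card_fin, nsmul_eq_mul]
    field_simp

lemma toMap_nonneg (hT : R.Tenable) {x : Fin m → Fin d → ℝ} (hx : ∀ l k, 0 ≤ x l k) (i : Fin d) :
    0 ≤ R.toMap x i :=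
  Finset.sum_nonneg fun c _ => mul_nonneg (hT i c) (Finset.prod_nonneg fun l _ => hx l _)

lemma sum_toMap (hB : R.Balanced σ) {x : Fin m → Fin d → ℝ} (hx : ∀ l, ∑ k, x l k = 1) :
    ∑ i, R.toMap x i = σ := by
  simp only [Tensor.toMap]
  rw [Finset.sum_comm]
  simp_rw [← Finset.sum_mul, hB.2, ← Finset.mul_sum, sum_prod_eq_one hx, mul_one]

lemma toMap_le (hT : R.Tenable) (hB : R.Balanced σ) {x : Fin d → ℝ}
    (hx : x ∈ stdSimplex ℝ (Fin d)) (i : Fin d) : R.toMap (fun _ => x) i ≤ σ := by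
  rw [← sum_toMap hB (x := fun _ => x) fun _ => hx.2]
  exact Finset.single_le_sum (f := fun i => R.toMap (fun _ => x) i)
    (fun j _ => toMap_nonneg hT (fun _ => hx.1) j) (Finset.mem_univ i)

lemma tensor_le (hT : R.Tenable) (hB : R.Balanced σ) (i : Fin d) (c : Fin m → Fin d) :
    R i c ≤ σ := by
  rw [← hB.2 c]
  exact Finset.single_le_sum (f := fun i => R i c) (fun j _ => hT j c) (Finset.mem_univ i)

lemma continuous_toMap : Continuous fun x : Fin d → ℝ => R.toMap (fun _ => x) := by
  unfold Tensor.toMap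
  fun_prop

lemma smul_toMap_mem (hT : R.Tenable) (hB : R.Balanced σ) {x : Fin d → ℝ}
    (hx : x ∈ stdSimplex ℝ (Fin d)) : σ⁻¹ • R.toMap (fun _ => x) ∈ stdSimplex ℝ (Fin d) := by
  have hσ := hB.1
  refine ⟨fun i => mul_nonneg (inv_nonneg.2 hσ.le) (toMap_nonneg hT (fun _ => hx.1) i), ?_⟩
  simp only [Pi.smul_apply, smul_eq_mul]
  rw [← Finset.mul_sum, sum_toMap hB fun _ => hx.2, inv_mul_cancel₀ hσ.ne']

/-- By compactness some `x` minimises the displacement `‖R(x, …, x) - σ x‖₁`. Its image under the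
contraction has displacement at most `κ` times as large, so the minimum is zero. -/
lemma exists_fixedPoint (hd : 1 ≤ d) (hm : 1 ≤ m) (hT : R.Tenable) (hB : R.Balanced σ)
    (hE : R.Ergodic σ) : ∃ x ∈ stdSimplex ℝ (Fin d), σ • x = R.toMap (fun _ => x) := by
  have hσ := hB.1
  obtain ⟨κ, -, hκ1, hκ⟩ := exists_contraction hd hm hB hE
  have hne : (stdSimplex ℝ (Fin d)).Nonempty := ⟨_, single_mem_stdSimplex ℝ (⟨0, hd⟩ : Fin d)⟩
  have hcont : Continuous fun x : Fin d → ℝ => ∑ i, |R.toMap (fun _ => x) i - σ * x i| := by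
    have := continuous_toMap (R := R)
    fun_prop
  obtain ⟨x, hx, hmin⟩ := (isCompact_stdSimplex ℝ (Fin d)).exists_isMinOn hne hcont.continuousOn
  refine ⟨x, hx, ?_⟩
  set y := σ⁻¹ • R.toMap (fun _ => x) with hy
  have hyx : ∀ i, R.toMap (fun _ => x) i = σ * y i := fun i => by
    simp [hy, hσ.ne']
  have h1 : ∑ i, |R.toMap (fun _ => x) i - σ * x i| ≤ ∑ i, |R.toMap (fun _ => y) i - σ * y i| :=
    hmin (smul_toMap_mem hT hB hx)
  have h2 : ∑ i, |R.toMap (fun _ => x) i - σ * x i| = σ * ∑ i, |y i - x i| := by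
    rw [Finset.mul_sum]
    refine Finset.sum_congr rfl fun i _ => ?_
    rw [hyx, ← mul_sub, abs_mul, abs_of_pos hσ]
  have h3 := hκ y (smul_toMap_mem hT hB hx) x hx
  simp_rw [hyx] at h3
  rw [h2] at h1
  have h4 : 0 ≤ ∑ i, |y i - x i| := Finset.sum_nonneg fun _ _ => abs_nonneg _
  have h5 : ∑ i, |y i - x i| = 0 := by
    refine le_antisymm ?_ h4
    have h6 : (1 - κ) * (σ * ∑ i, |y i - x i|) ≤ 0 := by nlinarith
    by_contra! h7
    exact absurd h6 (not_le.2 (mul_pos (by linarith) (mul_pos hσ h7)))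
  funext i
  have h6 := abs_eq_zero.1
    ((Finset.sum_eq_zero_iff_of_nonneg fun i _ => abs_nonneg (y i - x i)).1 h5 i (Finset.mem_univ i))
  rw [hyx, sub_eq_zero.1 h6]
  rfl

lemma fixedPoint_unique (hd : 1 ≤ d) (hm : 1 ≤ m) (hB : R.Balanced σ)
    (hE : R.Ergodic σ) {x y : Fin d → ℝ} (hx : x ∈ stdSimplex ℝ (Fin d))
    (hy : y ∈ stdSimplex ℝ (Fin d)) (hfx : σ • x = R.toMap (fun _ => x))
    (hfy : σ • y = R.toMap (fun _ => y)) : y = x := by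
  have hσ := hB.1
  obtain ⟨κ, -, hκ1, hκ⟩ := exists_contraction hd hm hB hE
  have h := hκ y hy x hx
  rw [← hfx, ← hfy] at h
  simp only [Pi.smul_apply, smul_eq_mul, ← mul_sub, abs_mul, abs_of_pos hσ] at h
  rw [← Finset.mul_sum, mul_assoc] at h
  have h' := le_of_mul_le_mul_left h hσ
  have h4 : 0 ≤ ∑ i, |y i - x i| := Finset.sum_nonneg fun _ _ => abs_nonneg _
  have h5 : ∑ i, |y i - x i| = 0 := by nlinarith
  funext i
  exact sub_eq_zero.1 (abs_eq_zero.1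
    ((Finset.sum_eq_zero_iff_of_nonneg fun i _ => abs_nonneg (y i - x i)).1 h5 i (Finset.mem_univ i)))

/-! ### Sequences dominated by their Cesàro means -/

/-- A bounded nonnegative sequence that is asymptotically at most `κ < 1` times its Cesàro means
tends to zero. -/
lemma tendsto_zero_of_le_cesaro {a ε : ℕ → ℝ} {κ B : ℝ} (ha : ∀ n, 0 ≤ a n) (haB : ∀ n, a n ≤ B)
    (hκ0 : 0 ≤ κ) (hκ1 : κ < 1) (hε : Tendsto ε atTop (nhds 0))
    (h : ∀ n, 1 ≤ n → a n ≤ ε n + κ * ((∑ k ∈ Finset.range n, a k) / n)) :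
    Tendsto a atTop (nhds 0) := by
  have hB0 : 0 ≤ B := (ha 0).trans (haB 0)
  set ρ := (κ + 1) / 2 with hρ
  -- An eventual bound `M` improves to `ρ * M`: the terms before `K` contribute at most `K * B / n`
  -- to the mean, and `κ < ρ` absorbs the vanishing errors. Using `B + 1` keeps `M` positive, so
  -- that `κ * M < ρ * M` is strict even when `B = 0`.
  have hpow : ∀ j : ℕ, ∀ᶠ n in atTop, a n ≤ ρ ^ j * (B + 1) := by
    intro j
    induction j with
    | zero => exact Eventually.of_forall fun n => by simpa using (haB n).trans (by linarith)
    | succ j ih =>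
      obtain ⟨K, hK⟩ := eventually_atTop.1 ih
      set M := ρ ^ j * (B + 1) with hM
      have hρ0 : 0 < ρ := by rw [hρ]; linarith
      have hM0 : 0 < M := mul_pos (pow_pos hρ0 j) (by linarith)
      have hlim : Tendsto (fun n : ℕ => ε n + κ * (K * B / n + M)) atTop
          (nhds (0 + κ * (0 + M))) :=
        hε.add (((tendsto_const_div_atTop_nhds_zero_nat (K * B)).add_const M).const_mul κ)
      have hlt : 0 + κ * (0 + M) < ρ ^ (j + 1) * (B + 1) := by
        have : ρ ^ (j + 1) * (B + 1) = ρ * M := by rw [hM]; ring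
        rw [this, hρ]; nlinarith
      filter_upwards [hlim.eventually_lt_const hlt, eventually_ge_atTop 1] with n hn hn1
      refine le_trans (h n hn1) (le_trans ?_ hn.le)
      have hn0 : (0 : ℝ) < n := by exact_mod_cast hn1
      have hsum : ∑ k ∈ Finset.range n, a k ≤ K * B + n * M := by
        calc ∑ k ∈ Finset.range n, a k
            ≤ ∑ k ∈ Finset.range n, ((if k < K then B else 0) + M) := by
              refine Finset.sum_le_sum fun k _ => ?_
              split_ifs with hk
              · linarith [haB k]
              · linarith [hK k (not_lt.1 hk)]
          _ = (∑ k ∈ Finset.range n, if k < K then B else 0) + n * M := by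
              rw [Finset.sum_add_distrib]; simp
          _ ≤ K * B + n * M := by
              rw [← Finset.sum_filter, Finset.sum_const, nsmul_eq_mul]
              have hc : ((Finset.range n).filter (· < K)).card ≤ K := by
                calc _ ≤ (Finset.range K).card := Finset.card_le_card fun k hk => by
                      simp only [Finset.mem_filter] at hk; simpa using hk.2
                  _ = K := Finset.card_range K
              have : (((Finset.range n).filter (· < K)).card : ℝ) ≤ K := by exact_mod_cast hc
              nlinarith
      have : (∑ k ∈ Finset.range n, a k) / n ≤ K * B / n + M := by
        rw [div_le_iff₀ hn0, add_mul, div_mul_cancel₀ _ hn0.ne']; linarith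
      nlinarith [mul_le_mul_of_nonneg_left this hκ0]
  have hρt : Tendsto (fun j : ℕ => ρ ^ j * (B + 1)) atTop (nhds 0) := by
    simpa using (tendsto_pow_atTop_nhds_zero_of_lt_one (by rw [hρ]; linarith)
      (by rw [hρ]; linarith)).mul_const (B + 1)
  rw [Metric.tendsto_atTop']
  intro e he
  obtain ⟨j, hj⟩ := (hρt.eventually_lt_const he).exists
  obtain ⟨N, hN⟩ := eventually_atTop.1 (hpow j)
  refine ⟨N, fun n hn => ?_⟩
  rw [Real.dist_eq, sub_zero, abs_of_nonneg (ha n)]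
  exact (hN n hn.le).trans_lt hj

end

/-! ### The martingale part of the urn -/

section

/-- The vector of proportions of the colours at time `n`. -/
noncomputable def proportion {Ω : Type*} {d : ℕ} (U : ℕ → Ω → Fin d → ℝ) (n : ℕ) (ω : Ω) :
    Fin d → ℝ :=
  (∑ i, U n ω i)⁻¹ • U n ω

/-- The martingale part of the number of balls of colour `i`. -/
noncomputable def martingalePart {Ω : Type*} {d m : ℕ} (R : Tensor d m) (U : ℕ → Ω → Fin d → ℝ)
    (i : Fin d) (n : ℕ) (ω : Ω) : ℝ :=
  U n ω i - U 0 ω i - ∑ k ∈ Finset.range n, R.toMap (fun _ => proportion U k ω) i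

variable {Ω : Type*} {d m : ℕ} {R : Tensor d m} {σ : ℝ} {U : ℕ → Ω → Fin d → ℝ}
  {C : ℕ → Ω → Fin m → Fin d}

lemma measurable_past {k n : ℕ} (hk : k ≤ n) : Measurable[past U n] (U k) :=
  (comap_measurable (U k)).mono
    (le_iSup (fun k : Fin (n + 1) => MeasurableSpace.comap (U k) inferInstance)
      ⟨k, Nat.lt_succ_of_le hk⟩) le_rfl

lemma measurable_proportion {k n : ℕ} (hk : k ≤ n) : Measurable[past U n] (proportion U k) := by
  have h : Measurable fun v : Fin d → ℝ => (∑ i, v i)⁻¹ • v := by fun_prop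
  exact h.comp (measurable_past hk)

lemma measurable_toMap_proportion {k n : ℕ} (hk : k ≤ n) (i : Fin d) :
    Measurable[past U n] fun ω => R.toMap (fun _ => proportion U k ω) i :=
  ((measurable_pi_apply i).comp continuous_toMap.measurable).comp (measurable_proportion hk)

lemma measurable_martingalePart (i : Fin d) (n : ℕ) :
    Measurable[past U n] (martingalePart R U i n) := by
  have h1 : ∀ k ≤ n, Measurable[past U n] fun ω => U k ω i := fun k hk =>
    (measurable_pi_apply i).comp (measurable_past hk)
  exact ((h1 n le_rfl).sub (h1 0 n.zero_le)).sub (Finset.measurable_fun_sum _ fun k hk =>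
    measurable_toMap_proportion (Finset.mem_range.1 hk).le i)

variable [MeasurableSpace Ω] {μ : Measure Ω}

lemma IsUrn.past_le (hU : IsUrn μ R U C) (n : ℕ) : past U n ≤ ‹MeasurableSpace Ω› :=
  iSup_le fun k => (hU.measurable_comp k).comap_le

lemma IsUrn.ae_total (hU : IsUrn μ R U C) (hB : R.Balanced σ) :
    ∀ᵐ ω ∂μ, ∀ n : ℕ, ∑ i, U n ω i = ∑ i, U 0 ω i + n * σ := by
  filter_upwards [ae_all_iff.2 hU.step] with ω hω n
  induction n with
  | zero => simp
  | succ n ih =>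
    simp_rw [hω n]
    rw [Finset.sum_add_distrib, ih, hB.2]
    push_cast
    ring

lemma IsUrn.ae_proportion_mem (hU : IsUrn μ R U C) (hB : R.Balanced σ)
    (h0 : ∀ᵐ ω ∂μ, 0 < ∑ i, U 0 ω i) :
    ∀ᵐ ω ∂μ, ∀ n, proportion U n ω ∈ stdSimplex ℝ (Fin d) := by
  have hσ := hB.1
  filter_upwards [hU.ae_total hB, h0, ae_all_iff.2 hU.nonneg] with ω h1 h2 h3 n
  have hpos : 0 < ∑ i, U n ω i := by rw [h1]; positivity
  refine ⟨fun i => mul_nonneg (inv_nonneg.2 hpos.le) (h3 n i), ?_⟩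
  simp only [proportion, Pi.smul_apply, smul_eq_mul]
  rw [← Finset.mul_sum, inv_mul_cancel₀ hpos.ne']

lemma IsUrn.ae_martingalePart_succ (hU : IsUrn μ R U C) (i : Fin d) (n : ℕ) :
    ∀ᵐ ω ∂μ, martingalePart R U i (n + 1) ω = martingalePart R U i n ω +
      (R i (C n ω) - R.toMap (fun _ => proportion U n ω) i) := by
  filter_upwards [hU.step n] with ω hω
  rw [martingalePart, martingalePart, Finset.sum_range_succ, hω]
  ring

lemma IsUrn.ae_abs_increment_le (hU : IsUrn μ R U C) (hT : R.Tenable) (hB : R.Balanced σ)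
    (h0 : ∀ᵐ ω ∂μ, 0 < ∑ i, U 0 ω i) (i : Fin d) (n : ℕ) :
    ∀ᵐ ω ∂μ, |R i (C n ω) - R.toMap (fun _ => proportion U n ω) i| ≤ σ := by
  filter_upwards [hU.ae_proportion_mem hB h0] with ω hω
  have h1 := toMap_le hT hB (hω n) i
  have h2 := toMap_nonneg hT (fun _ : Fin m => (hω n).1) i
  have h3 := hT i (C n ω)
  have h4 := tensor_le hT hB i (C n ω)
  exact abs_le.2 ⟨by linarith, by linarith⟩

/-- Since `U 0` is subtracted, the martingale starts at zero and is bounded at each time, whatever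
the moments of `U 0`. All the integrability below rests on this. -/
lemma IsUrn.ae_abs_martingalePart_le (hU : IsUrn μ R U C) (hT : R.Tenable) (hB : R.Balanced σ)
    (h0 : ∀ᵐ ω ∂μ, 0 < ∑ i, U 0 ω i) (i : Fin d) (n : ℕ) :
    ∀ᵐ ω ∂μ, |martingalePart R U i n ω| ≤ n * σ := by
  induction n with
  | zero => exact Eventually.of_forall fun ω => by simp [martingalePart]
  | succ n ih =>
    filter_upwards [ih, hU.ae_martingalePart_succ i n, hU.ae_abs_increment_le hT hB h0 i n]
      with ω h1 h2 h3
    rw [h2]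
    refine (abs_add_le _ _).trans ((add_le_add h1 h3).trans (le_of_eq ?_))
    push_cast
    ring

lemma IsUrn.measurable_draw_tensor (hU : IsUrn μ R U C) (i : Fin d) (n : ℕ) :
    Measurable fun ω => R i (C n ω) :=
  (measurable_of_finite (R i)).comp (hU.measurable_draw n)

lemma IsUrn.condExp_draw [IsProbabilityMeasure μ] (hU : IsUrn μ R U C) (i : Fin d) (n : ℕ) :
    μ[fun ω => R i (C n ω) | past U n]
      =ᵐ[μ] fun ω => R.toMap (fun _ => proportion U n ω) i := by
  have hmeas : ∀ c, MeasurableSet {ω | C n ω = c} := fun c =>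
    hU.measurable_draw n (measurableSet_singleton c)
  have hdec : (fun ω => R i (C n ω))
      = ∑ c, R i c • Set.indicator {ω | C n ω = c} (fun _ => (1 : ℝ)) := by
    classical
    funext ω
    simp [Finset.sum_apply, Set.indicator_apply]
  rw [hdec]
  refine (condExp_finsetSum (fun c _ => ((integrable_const (1 : ℝ)).indicator
    (hmeas c)).smul (R i c)) _).trans ?_
  have hc : ∀ᵐ ω ∂μ, ∀ c,
      (μ[R i c • Set.indicator {ω | C n ω = c} (fun _ => (1 : ℝ)) | past U n]) ω
        = R i c * ∏ l, (U n ω (c l) / ∑ i, U n ω i) := by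
    refine ae_all_iff.2 fun c => ?_
    filter_upwards [hU.draw n c, condExp_smul (μ := μ) (R i c)
      (Set.indicator {ω | C n ω = c} (fun _ => (1 : ℝ))) (past U n)] with ω h1 h2
    rw [h2, Pi.smul_apply, h1, smul_eq_mul]
  filter_upwards [hc] with ω hω
  simp only [Finset.sum_apply, hω, Tensor.toMap, proportion, Pi.smul_apply, smul_eq_mul,
    div_eq_inv_mul]

lemma IsUrn.integrable_increment [IsProbabilityMeasure μ] (hU : IsUrn μ R U C) (hT : R.Tenable)
    (hB : R.Balanced σ) (h0 : ∀ᵐ ω ∂μ, 0 < ∑ i, U 0 ω i) (i : Fin d) (n : ℕ) :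
    Integrable (fun ω => R i (C n ω) - R.toMap (fun _ => proportion U n ω) i) μ :=
  Integrable.of_bound ((hU.measurable_draw_tensor i n).sub
    ((measurable_toMap_proportion le_rfl i).mono (hU.past_le n) le_rfl)).aestronglyMeasurable σ
    (hU.ae_abs_increment_le hT hB h0 i n)

/-- Orthogonality of increments: the martingale is bounded and known from the past, and the next
increment has zero conditional mean by `IsUrn.condExp_draw`. -/
lemma IsUrn.integral_martingalePart_mul_increment [IsProbabilityMeasure μ] (hU : IsUrn μ R U C)
    (hT : R.Tenable) (hB : R.Balanced σ) (h0 : ∀ᵐ ω ∂μ, 0 < ∑ i, U 0 ω i) (i : Fin d) (n : ℕ) :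
    ∫ ω, martingalePart R U i n ω *
      (R i (C n ω) - R.toMap (fun _ => proportion U n ω) i) ∂μ = 0 := by
  have hR : Integrable (fun ω => R i (C n ω)) μ :=
    Integrable.of_bound (hU.measurable_draw_tensor i n).aestronglyMeasurable σ
      (Eventually.of_forall fun ω => by
        rw [Real.norm_eq_abs, abs_of_nonneg (hT _ _)]; exact tensor_le hT hB _ _)
  have hM : Integrable (fun ω => R.toMap (fun _ => proportion U n ω) i) μ := by
    refine (hR.sub (hU.integrable_increment hT hB h0 i n)).congr (Eventually.of_forall fun ω => ?_)
    simp
  have hzero : μ[fun ω => R i (C n ω) - R.toMap (fun _ => proportion U n ω) i | past U n]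
      =ᵐ[μ] 0 := by
    have h1 := condExp_sub hR hM (past U n)
    have h2 : μ[fun ω => R.toMap (fun _ => proportion U n ω) i | past U n]
        = fun ω => R.toMap (fun _ => proportion U n ω) i :=
      condExp_of_stronglyMeasurable (hU.past_le n)
        (measurable_toMap_proportion le_rfl i).stronglyMeasurable hM
    filter_upwards [h1, hU.condExp_draw i n] with ω e1 e2
    refine e1.trans ?_
    rw [Pi.sub_apply, e2, h2, sub_self, Pi.zero_apply]
  have hpull := condExp_stronglyMeasurable_mul_of_bound (hU.past_le n)
    (measurable_martingalePart (R := R) i n).stronglyMeasurable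
    (hU.integrable_increment hT hB h0 i n) (n * σ) (hU.ae_abs_martingalePart_le hT hB h0 i n)
  rw [← integral_condExp (hU.past_le n)]
  refine integral_eq_zero_of_ae (hpull.trans ?_)
  filter_upwards [hzero] with ω hω
  rw [Pi.mul_apply, hω, Pi.zero_apply, mul_zero]

lemma IsUrn.integrable_sq_martingalePart [IsProbabilityMeasure μ] (hU : IsUrn μ R U C)
    (hT : R.Tenable) (hB : R.Balanced σ) (h0 : ∀ᵐ ω ∂μ, 0 < ∑ i, U 0 ω i) (i : Fin d) (n : ℕ) :
    Integrable (fun ω => martingalePart R U i n ω ^ 2) μ := by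
  refine Integrable.of_bound (((measurable_martingalePart i n).mono (hU.past_le n)
    le_rfl).pow_const 2).aestronglyMeasurable ((n * σ) ^ 2) ?_
  filter_upwards [hU.ae_abs_martingalePart_le hT hB h0 i n] with ω hω
  rw [norm_pow]
  exact pow_le_pow_left₀ (norm_nonneg _) hω 2

lemma IsUrn.integrable_martingalePart [IsProbabilityMeasure μ] (hU : IsUrn μ R U C)
    (hT : R.Tenable) (hB : R.Balanced σ) (h0 : ∀ᵐ ω ∂μ, 0 < ∑ i, U 0 ω i) (i : Fin d) (n : ℕ) :
    Integrable (martingalePart R U i n) μ :=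
  Integrable.of_bound ((measurable_martingalePart i n).mono (hU.past_le n)
    le_rfl).aestronglyMeasurable (n * σ) (hU.ae_abs_martingalePart_le hT hB h0 i n)

lemma IsUrn.integral_sq_martingalePart_le [IsProbabilityMeasure μ] (hU : IsUrn μ R U C)
    (hT : R.Tenable) (hB : R.Balanced σ) (h0 : ∀ᵐ ω ∂μ, 0 < ∑ i, U 0 ω i) (i : Fin d) (n : ℕ) :
    ∫ ω, martingalePart R U i n ω ^ 2 ∂μ ≤ n * σ ^ 2 := by
  induction n with
  | zero => simp [martingalePart]
  | succ n ih =>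
    have hcross : Integrable (fun ω => martingalePart R U i n ω *
        (R i (C n ω) - R.toMap (fun _ => proportion U n ω) i)) μ :=
      (hU.integrable_increment hT hB h0 i n).bdd_mul
        (hU.integrable_martingalePart hT hB h0 i n).aestronglyMeasurable
        (hU.ae_abs_martingalePart_le hT hB h0 i n)
    calc ∫ ω, martingalePart R U i (n + 1) ω ^ 2 ∂μ
        ≤ ∫ ω, (martingalePart R U i n ω ^ 2 + 2 * (martingalePart R U i n ω *
            (R i (C n ω) - R.toMap (fun _ => proportion U n ω) i)) + σ ^ 2) ∂μ := by
          refine integral_mono_ae (hU.integrable_sq_martingalePart hT hB h0 i (n + 1))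
            (((hU.integrable_sq_martingalePart hT hB h0 i n).add (hcross.const_mul 2)).add
              (integrable_const _)) ?_
          filter_upwards [hU.ae_martingalePart_succ i n, hU.ae_abs_increment_le hT hB h0 i n]
            with ω h1 h2
          have h3 := sq_le_sq' (by linarith [abs_le.1 h2]) (abs_le.1 h2).2
          simp only [h1]
          linarith
      _ = ∫ ω, martingalePart R U i n ω ^ 2 ∂μ + σ ^ 2 := by
          have hsum : Integrable (fun ω => martingalePart R U i n ω ^ 2 + 2 *
              (martingalePart R U i n ω *
                (R i (C n ω) - R.toMap (fun _ => proportion U n ω) i))) μ :=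
            (hU.integrable_sq_martingalePart hT hB h0 i n).add (hcross.const_mul 2)
          rw [integral_add hsum (integrable_const _),
            integral_add (hU.integrable_sq_martingalePart hT hB h0 i n) (hcross.const_mul 2),
            integral_const_mul, hU.integral_martingalePart_mul_increment hT hB h0 i n]
          simp
      _ ≤ (n + 1 : ℕ) * σ ^ 2 := by
          push_cast
          linarith

lemma IsUrn.integral_abs_martingalePart_div_le [IsProbabilityMeasure μ] (hU : IsUrn μ R U C)
    (hT : R.Tenable) (hB : R.Balanced σ) (h0 : ∀ᵐ ω ∂μ, 0 < ∑ i, U 0 ω i) (i : Fin d) {n : ℕ}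
    (hn : 1 ≤ n) :
    (∫ ω, |martingalePart R U i n ω| ∂μ) / n ≤ (σ ^ 2 + 1) / 2 / √n := by
  have hn0 : (0 : ℝ) < n := by exact_mod_cast hn
  have hs : 0 < √(n : ℝ) := Real.sqrt_pos.2 hn0
  have hss : √(n : ℝ) * √(n : ℝ) = n := Real.mul_self_sqrt hn0.le
  -- The inequality `2 s |M| ≤ M ^ 2 + s ^ 2` with `s = √n`, which balances the second moment of
  -- order `n`.
  have h1 : ∫ ω, |martingalePart R U i n ω| ∂μ
      ≤ ∫ ω, (martingalePart R U i n ω ^ 2 * (2 * √(n : ℝ))⁻¹ + √(n : ℝ) / 2) ∂μ := by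
    refine integral_mono (hU.integrable_martingalePart hT hB h0 i n).abs
      (((hU.integrable_sq_martingalePart hT hB h0 i n).mul_const _).add (integrable_const _))
      fun ω => ?_
    have h2 : martingalePart R U i n ω ^ 2 * (2 * √(n : ℝ))⁻¹ + √(n : ℝ) / 2
        - |martingalePart R U i n ω|
        = (|martingalePart R U i n ω| - √(n : ℝ)) ^ 2 * (2 * √(n : ℝ))⁻¹ := by
      rw [← sq_abs (martingalePart R U i n ω)]
      field_simp
      ring
    have h3 : 0 ≤ (|martingalePart R U i n ω| - √(n : ℝ)) ^ 2 * (2 * √(n : ℝ))⁻¹ := by positivity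
    simp only
    linarith
  rw [integral_add ((hU.integrable_sq_martingalePart hT hB h0 i n).mul_const _)
    (integrable_const _), integral_mul_const] at h1
  have h4 := mul_le_mul_of_nonneg_right (hU.integral_sq_martingalePart_le hT hB h0 i n)
    (show 0 ≤ (2 * √(n : ℝ))⁻¹ by positivity)
  have h5 : n * σ ^ 2 * (2 * √(n : ℝ))⁻¹ + √(n : ℝ) / 2 = (σ ^ 2 + 1) / 2 / √n * n := by
    generalize √(n : ℝ) = s at hs hss
    rw [← hss]
    field_simp
  rw [div_le_iff₀ hn0, ← h5]
  simp only [integral_const, probReal_univ, one_smul] at h1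
  linarith

end

/-! ### Convergence to the fixed point -/

section

lemma sum_abs_sub_le_two {d : ℕ} {x y : Fin d → ℝ} (hx : x ∈ stdSimplex ℝ (Fin d))
    (hy : y ∈ stdSimplex ℝ (Fin d)) : ∑ i, |x i - y i| ≤ 2 := by
  calc ∑ i, |x i - y i| ≤ ∑ i, (x i + y i) := Finset.sum_le_sum fun i _ =>
        abs_le.2 ⟨by linarith [hx.1 i, hy.1 i], by linarith [hx.1 i, hy.1 i]⟩
    _ = 2 := by rw [Finset.sum_add_distrib, hx.2, hy.2]; norm_num

variable {Ω : Type*} [MeasurableSpace Ω] {μ : Measure Ω} {d m : ℕ} {R : Tensor d m} {σ : ℝ}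
  {U : ℕ → Ω → Fin d → ℝ} {C : ℕ → Ω → Fin m → Fin d}

/-- The `ℓ¹`-distance from the proportions to the fixed point is controlled by its past Cesàro
mean, the initial composition and the martingale part. -/
lemma IsUrn.ae_sum_abs_proportion_sub_le (hU : IsUrn μ R U C) (hB : R.Balanced σ)
    (h0 : ∀ᵐ ω ∂μ, 0 < ∑ i, U 0 ω i) {κ : ℝ} (hκ0 : 0 ≤ κ)
    (hκ : ∀ x ∈ stdSimplex ℝ (Fin d), ∀ y ∈ stdSimplex ℝ (Fin d),
      ∑ i, |R.toMap (fun _ => x) i - R.toMap (fun _ => y) i| ≤ σ * κ * ∑ k, |x k - y k|)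
    {x : Fin d → ℝ} (hx : x ∈ stdSimplex ℝ (Fin d)) (hfix : σ • x = R.toMap (fun _ => x))
    {n : ℕ} (hn : 1 ≤ n) :
    ∀ᵐ ω ∂μ, ∑ i, |proportion U n ω i - x i| ≤ min 2 (2 * (∑ i, U 0 ω i) / σ / n) +
      (κ * ((∑ k ∈ Finset.range n, ∑ i, |proportion U k ω i - x i|) / n) +
        σ⁻¹ * ∑ i, |martingalePart R U i n ω| / n) := by
  have hσ := hB.1
  have hn0 : (0 : ℝ) < n := by exact_mod_cast hn
  filter_upwards [hU.ae_total hB, h0, hU.ae_proportion_mem hB h0, hU.nonneg 0]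
    with ω htot hpos hmem hnonneg
  set T := ∑ i, U 0 ω i with hT
  set D : ℕ → ℝ := fun k => ∑ i, |proportion U k ω i - x i| with hD
  have hD0 : ∀ k, 0 ≤ D k := fun k => Finset.sum_nonneg fun _ _ => abs_nonneg _
  have hTn : 0 < ∑ i, U n ω i := by rw [htot]; positivity
  -- As `σ • x` is the drift at `x`, the vector `(T + n σ) x` splits into `T x` and `n` copies of
  -- that drift, matched with the drifts of the urn.
  have hid : ∀ i, (∑ i, U n ω i) * (proportion U n ω i - x i) = (U 0 ω i - T * x i) +
      (∑ k ∈ Finset.range n, (R.toMap (fun _ => proportion U k ω) i - R.toMap (fun _ => x) i)) +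
      martingalePart R U i n ω := fun i => by
    rw [Finset.sum_sub_distrib, ← hfix, mul_sub, proportion, Pi.smul_apply, smul_eq_mul,
      mul_inv_cancel_left₀ hTn.ne', htot, martingalePart]
    simp only [Finset.sum_const, Finset.card_range, Pi.smul_apply, smul_eq_mul, nsmul_eq_mul]
    ring
  have hinit : ∑ i, |U 0 ω i - T * x i| ≤ 2 * T := by
    calc ∑ i, |U 0 ω i - T * x i| ≤ ∑ i, (U 0 ω i + T * x i) := Finset.sum_le_sum fun i _ => by
          have := mul_nonneg hpos.le (hx.1 i)
          exact abs_le.2 ⟨by linarith [hnonneg i], by linarith [hnonneg i]⟩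
      _ = 2 * T := by rw [Finset.sum_add_distrib, ← Finset.mul_sum, hx.2]; ring
  have hdrift : ∑ i, |∑ k ∈ Finset.range n,
      (R.toMap (fun _ => proportion U k ω) i - R.toMap (fun _ => x) i)|
        ≤ σ * κ * ∑ k ∈ Finset.range n, D k := by
    calc _ ≤ ∑ i, ∑ k ∈ Finset.range n,
          |R.toMap (fun _ => proportion U k ω) i - R.toMap (fun _ => x) i| :=
          Finset.sum_le_sum fun i _ => Finset.abs_sum_le_sum_abs _ _
      _ ≤ σ * κ * ∑ k ∈ Finset.range n, D k := by
          rw [Finset.sum_comm, Finset.mul_sum]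
          exact Finset.sum_le_sum fun k _ => hκ _ (hmem k) x hx
  have hmain : n * σ * D n ≤ 2 * T + σ * κ * ∑ k ∈ Finset.range n, D k +
      ∑ i, |martingalePart R U i n ω| := by
    calc n * σ * D n ≤ (∑ i, U n ω i) * D n :=
          mul_le_mul_of_nonneg_right (by rw [htot]; linarith) (hD0 n)
      _ = ∑ i, |(U 0 ω i - T * x i) + (∑ k ∈ Finset.range n,
            (R.toMap (fun _ => proportion U k ω) i - R.toMap (fun _ => x) i)) +
            martingalePart R U i n ω| := by
          rw [hD, Finset.mul_sum]
          refine Finset.sum_congr rfl fun i _ => ?_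
          rw [← hid, abs_mul, abs_of_pos hTn]
      _ ≤ ∑ i, (|U 0 ω i - T * x i| + |∑ k ∈ Finset.range n,
            (R.toMap (fun _ => proportion U k ω) i - R.toMap (fun _ => x) i)| +
            |martingalePart R U i n ω|) := Finset.sum_le_sum fun i _ => abs_add_three _ _ _
      _ ≤ _ := by
          rw [Finset.sum_add_distrib, Finset.sum_add_distrib]
          linarith
  rw [← Finset.sum_div]
  set Q := κ * ((∑ k ∈ Finset.range n, D k) / n) +
    σ⁻¹ * ((∑ i, |martingalePart R U i n ω|) / n) with hQ
  have hQ0 : 0 ≤ Q := by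
    have : 0 ≤ ∑ k ∈ Finset.range n, D k := Finset.sum_nonneg fun k _ => hD0 k
    positivity
  have hDn : D n ≤ 2 * T / σ / n + Q := by
    have : 2 * T / σ / n + Q = (2 * T + σ * κ * ∑ k ∈ Finset.range n, D k +
      ∑ i, |martingalePart R U i n ω|) / (n * σ) := by
      rw [hQ]; field_simp; ring
    rw [this, le_div_iff₀ (by positivity)]
    linarith
  -- Two bounds on `D n` are combined: the trivial bound `2` and the recursive one. The minimum
  -- keeps the initial term integrable.
  rw [← min_add_add_right]
  exact le_min (by linarith [sum_abs_sub_le_two (hmem n) hx]) hDn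

lemma IsUrn.measurable_proportion (hU : IsUrn μ R U C) (n : ℕ) : Measurable (proportion U n) :=
  (MultiDrawUrn.measurable_proportion le_rfl).mono (hU.past_le n) le_rfl

lemma IsUrn.integrable_sum_abs_proportion_sub [IsProbabilityMeasure μ] (hU : IsUrn μ R U C)
    (hB : R.Balanced σ) (h0 : ∀ᵐ ω ∂μ, 0 < ∑ i, U 0 ω i) {x : Fin d → ℝ}
    (hx : x ∈ stdSimplex ℝ (Fin d)) (n : ℕ) :
    Integrable (fun ω => ∑ i, |proportion U n ω i - x i|) μ := by
  have hc : Continuous fun v : Fin d → ℝ => ∑ i, |v i - x i| := by fun_prop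
  refine Integrable.of_bound (hc.measurable.comp (hU.measurable_proportion n)).aestronglyMeasurable
    2 ?_
  filter_upwards [hU.ae_proportion_mem hB h0] with ω hω
  rw [Real.norm_eq_abs, abs_of_nonneg (Finset.sum_nonneg fun _ _ => abs_nonneg _)]
  exact sum_abs_sub_le_two (hω n) hx

/-- Truncation at `2` permits dominated convergence without any moment of `Y`, so the random initial
total needs none. -/
lemma tendsto_integral_min_div [IsProbabilityMeasure μ] {Y : Ω → ℝ} (hY : Measurable Y)
    (hpos : ∀ᵐ ω ∂μ, 0 ≤ Y ω) :
    Tendsto (fun n : ℕ => ∫ ω, min 2 (Y ω / n) ∂μ) atTop (nhds 0) := by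
  have h := tendsto_integral_of_dominated_convergence (μ := μ)
    (F := fun (n : ℕ) ω => min 2 (Y ω / n)) (f := fun _ => (0 : ℝ)) (fun _ => 2)
    (fun n => (measurable_const.min (hY.div_const _)).aestronglyMeasurable)
    (integrable_const _) (fun n => ?_) (Eventually.of_forall fun ω => ?_)
  · simpa using h
  · filter_upwards [hpos] with ω hω
    rw [Real.norm_eq_abs, abs_of_nonneg (by positivity)]
    exact min_le_left _ _
  · simpa using (tendsto_const_nhds (x := (2 : ℝ))).min (tendsto_const_div_atTop_nhds_zero_nat (Y ω))

lemma IsUrn.tendsto_integral_sum_abs_proportion_sub [IsProbabilityMeasure μ]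
    (hU : IsUrn μ R U C) (hd : 1 ≤ d) (hm : 1 ≤ m) (hT : R.Tenable) (hB : R.Balanced σ)
    (hE : R.Ergodic σ) (h0 : ∀ᵐ ω ∂μ, 0 < ∑ i, U 0 ω i) {x : Fin d → ℝ}
    (hx : x ∈ stdSimplex ℝ (Fin d)) (hfix : σ • x = R.toMap (fun _ => x)) :
    Tendsto (fun n => ∫ ω, ∑ i, |proportion U n ω i - x i| ∂μ) atTop (nhds 0) := by
  have hσ := hB.1
  obtain ⟨κ, hκ0, hκ1, hκ⟩ := exists_contraction hd hm hB hE
  have hint := hU.integrable_sum_abs_proportion_sub hB h0 hx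
  have hYm : Measurable fun ω => 2 * (∑ i, U 0 ω i) / σ := by
    have hc : Continuous fun v : Fin d → ℝ => 2 * (∑ i, v i) / σ := by fun_prop
    exact hc.measurable.comp (hU.measurable_comp 0)
  have hYpos : ∀ᵐ ω ∂μ, 0 ≤ 2 * (∑ i, U 0 ω i) / σ := by
    filter_upwards [h0] with ω hω
    positivity
  -- The error in the Cesàro inequality: the truncated initial term, and the `L¹` bound of order `1
  -- / √n` summed over the `d` colours.
  have hε : Tendsto (fun n : ℕ => ∫ ω, min 2 (2 * (∑ i, U 0 ω i) / σ / n) ∂μ +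
      σ⁻¹ * (d * ((σ ^ 2 + 1) / 2 / √(n : ℝ)))) atTop (nhds 0) := by
    have h2 : Tendsto (fun n : ℕ => (σ ^ 2 + 1) / 2 / √(n : ℝ)) atTop (nhds 0) :=
      (Real.tendsto_sqrt_atTop.comp tendsto_natCast_atTop_atTop).const_div_atTop _
    simpa using (tendsto_integral_min_div hYm hYpos).add ((h2.const_mul (d : ℝ)).const_mul σ⁻¹)
  refine tendsto_zero_of_le_cesaro (B := 2)
    (fun n => integral_nonneg fun ω => Finset.sum_nonneg fun _ _ => abs_nonneg _)
    (fun n => ?_) hκ0 hκ1 hε (fun n hn => ?_)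
  · refine (integral_mono_ae (hint n) (integrable_const 2) ?_).trans (by simp)
    filter_upwards [hU.ae_proportion_mem hB h0] with ω hω
    exact sum_abs_sub_le_two (hω n) hx
  · have i1 : Integrable (fun ω => min 2 (2 * (∑ i, U 0 ω i) / σ / n)) μ := by
      refine Integrable.of_bound
        (measurable_const.min (hYm.div_const _)).aestronglyMeasurable 2 ?_
      filter_upwards [hYpos] with ω hω
      rw [Real.norm_eq_abs, abs_of_nonneg (by positivity)]
      exact min_le_left _ _
    have i2 : Integrable (fun ω =>
        κ * ((∑ k ∈ Finset.range n, ∑ i, |proportion U k ω i - x i|) / n)) μ :=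
      ((integrable_finsetSum _ fun k _ => hint k).div_const _).const_mul κ
    have i4 : ∀ i ∈ (Finset.univ : Finset (Fin d)),
        Integrable (fun ω => |martingalePart R U i n ω| / n) μ := fun i _ =>
      (hU.integrable_martingalePart hT hB h0 i n).abs.div_const _
    have i3 : Integrable (fun ω => σ⁻¹ * ∑ i, |martingalePart R U i n ω| / n) μ :=
      (integrable_finsetSum _ i4).const_mul _
    have h := integral_mono_ae (hint n) (i1.add (i2.add i3))
      (hU.ae_sum_abs_proportion_sub_le hB h0 hκ0 hκ hx hfix hn)
    rw [integral_add' i1 (i2.add i3), integral_add' i2 i3, integral_const_mul, integral_const_mul,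
      integral_div, integral_finsetSum _ fun k _ => hint k, integral_finsetSum _ i4] at h
    have hN : ∑ i, ∫ ω, |martingalePart R U i n ω| / n ∂μ ≤ d * ((σ ^ 2 + 1) / 2 / √(n : ℝ)) := by
      calc _ ≤ ∑ _i : Fin d, (σ ^ 2 + 1) / 2 / √(n : ℝ) := Finset.sum_le_sum fun i _ => by
            rw [integral_div]
            exact hU.integral_abs_martingalePart_div_le hT hB h0 i hn
        _ = _ := by simp
    have := mul_le_mul_of_nonneg_left hN (inv_nonneg.2 hσ.le)
    linarith

lemma IsUrn.tendstoInMeasure_proportion [IsProbabilityMeasure μ]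
    (hU : IsUrn μ R U C) (hd : 1 ≤ d) (hm : 1 ≤ m) (hT : R.Tenable) (hB : R.Balanced σ)
    (hE : R.Ergodic σ) (h0 : ∀ᵐ ω ∂μ, 0 < ∑ i, U 0 ω i) {x : Fin d → ℝ}
    (hx : x ∈ stdSimplex ℝ (Fin d)) (hfix : σ • x = R.toMap (fun _ => x)) :
    TendstoInMeasure μ (proportion U) atTop (fun _ => x) := by
  refine tendstoInMeasure_of_tendsto_eLpNorm one_ne_zero
    (fun n => (hU.measurable_proportion n).aestronglyMeasurable) aestronglyMeasurable_const ?_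
  have hlim := ENNReal.tendsto_ofReal
    (hU.tendsto_integral_sum_abs_proportion_sub hd hm hT hB hE h0 hx hfix)
  rw [ENNReal.ofReal_zero] at hlim
  refine tendsto_of_tendsto_of_tendsto_of_le_of_le tendsto_const_nhds hlim (fun _ => zero_le)
    fun n => ?_
  simp only
  rw [ofReal_integral_eq_lintegral_ofReal (hU.integrable_sum_abs_proportion_sub hB h0 hx n)
    (Eventually.of_forall fun ω => Finset.sum_nonneg fun _ _ => abs_nonneg _),
    eLpNorm_one_eq_lintegral_enorm]
  refine lintegral_mono fun ω => ?_
  rw [← ofReal_norm]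
  -- The norm on `Fin d → ℝ` is the sup norm, which the `ℓ¹`-norm dominates.
  refine ENNReal.ofReal_le_ofReal ((pi_norm_le_iff_of_nonneg
    (Finset.sum_nonneg fun _ _ => abs_nonneg _)).2 fun i => ?_)
  exact Finset.single_le_sum (f := fun i => |proportion U n ω i - x i|)
    (fun _ _ => abs_nonneg _) (Finset.mem_univ i)

end

end MultiDrawUrn

theorem mainTheorem3 (d m : ℕ) (hd : 1 ≤ d) (hm : 1 ≤ m) (R : MultiDrawUrn.Tensor d m) (σ : ℝ)
    (hT : R.Tenable) (hB : R.Balanced σ) (hE : R.Ergodic σ) :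
    ∃ x : Fin d → ℝ,
      (x ∈ stdSimplex ℝ (Fin d) ∧ σ • x = R.toMap (fun _ => x)) ∧
      (∀ y ∈ stdSimplex ℝ (Fin d), σ • y = R.toMap (fun _ => y) → y = x) ∧
      ∀ (Ω : Type*) [MeasurableSpace Ω] (μ : Measure Ω) [IsProbabilityMeasure μ]
        (U : ℕ → Ω → Fin d → ℝ) (C : ℕ → Ω → Fin m → Fin d),
        MultiDrawUrn.IsUrn μ R U C →
        (∀ᵐ ω ∂μ, 0 < ∑ i, U 0 ω i) →
        TendstoInMeasure μ (fun n ω => (∑ i, U n ω i)⁻¹ • U n ω) atTop (fun _ => x) := by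
  obtain ⟨x, hx, hfix⟩ := MultiDrawUrn.exists_fixedPoint hd hm hT hB hE
  exact ⟨x, ⟨hx, hfix⟩,
    fun y hy hfy => MultiDrawUrn.fixedPoint_unique hd hm hB hE hx hy hfix hfy,
    fun Ω _ μ _ U C hU h0 => hU.tendstoInMeasure_proportion hd hm hT hB hE h0 hx hfix⟩
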